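/- Let $p$ be an odd prime. There is a constant $\sigma_p>0$ depending only on $p$ (namely, one may take $\sigma_p=6p-4$) such that the following holds. Let $\mathbb{F}_q$ be a finite field of characteristic $p$ with $q$ elements, let $\psi_q:\mathbb{F}_q\to\overline{\mathbb{Q}}^{\times}$ be a nontrivial additive character, fix an embedding $\iota:\overline{\mathbb{Q}}\hookrightarrow\mathbb{C}$, and let $\gamma\in\mathbb{F}_q^\times$ and $a\geq 1$ an integer. Let $P_q(a)$ be the set of places $v\neq 0,\infty$ of $K=\mathbb{F}_q(t)$ whose degree $\deg v=[\mathbb{F}_v:\mathbb{F}_q]$ divides $a$, where $\mathbb{F}_v$ is the residue field at $v$. For $v\in P_q(a)$, let $\beta_v\in\mathbb{F}_v^\times$ be the class of $t$ (any other conjugate of it over $\mathbb{F}_q$ gives the same sum), and put $$\mathsf{Kl}_\gamma(v)=-\sum_{x\in\mathbb{F}_v^\times}\psi_q\Big(\mathrm{Tr}_{\mathbb{F}_v/\mathbb{F}_q}\big(\beta_v(x+\gamma/x)\big)\Big)\in\overline{\mathbb{Q}}.$$ Then $\iota(\mathsf{Kl}_\gamma(v))$ is real with $|\iota(\mathsf{Kl}_\gamma(v))|\le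 2q^{\deg v/2}$, so that there is a unique angle $\theta_\gamma(v)\in[0,\pi]$ with $\iota(\mathsf{Kl}_\gamma(v))=2q^{\deg v/2}\cos\theta_\gamma(v)$; and $$\{\theta_\gamma(v)\}_{v\in P_q(a)}\subset\big[\epsilon_a,\tfrac{\pi}{2}-\epsilon_a\big]\cup\big[\tfrac{\pi}{2}+\epsilon_a,\pi-\epsilon_a\big],\qquad \epsilon_a=(q^a)^{-\sigma_p}.$$ In other words, the measure $\mu_a=\frac{1}{|P_q(a)|}\sum_{v\in P_q(a)}\delta_{\theta_\gamma(v)}$ is supported on $[\epsilon_a,\frac{\pi}{2}-\epsilon_a]\cup[\frac{\pi}{2}+\epsilon_a,\pi-\epsilon_a]$. -/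

import Mathlib

open Polynomial IsDedekindDomain MeasureTheory

noncomputable section

/-- The Kloosterman sum `- ∑_{x ∈ kˣ} ψ (x + α / x)` of a finite field `k`
(with the normalising sign `-1`). -/
def kloostermanSum {k R : Type*} [Field k] [Finite k] [CommRing R]
    (ψ : AddChar k R) (α : k) : R :=
  letI := Fintype.ofFinite kˣ;
  (-∑ x : kˣ, ψ ((x : k) + α / (x : k)))

section Places

variable {F : Type*} [Field F]

/-- The residue field `F_v = F[t] / v` of `K = F(t)` at a finite place `v`. A finite place of `K`
is a nonzero prime ideal of `F[t]`. -/
abbrev ResField (v : HeightOneSpectrum F[X]) : Type _ := F[X] ⧸ v.asIdeal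

instance ResField.instField (v : HeightOneSpectrum F[X]) : Field (ResField v) :=
  haveI := v.isMaximal
  Ideal.Quotient.field v.asIdeal

instance ResField.instFinite [Finite F] (v : HeightOneSpectrum F[X]) : Finite (ResField v) := by
  obtain ⟨f, hf⟩ := IsPrincipalIdealRing.principal v.asIdeal
  have hf0 : f ≠ 0 := by
    rintro rfl
    exact v.ne_bot (by rw [hf]; simp)
  have : Module.Finite F (AdjoinRoot f) := (AdjoinRoot.powerBasis hf0).finite
  have : Finite (AdjoinRoot f) := Module.finite_of_finite F
  have e : v.asIdeal = Ideal.span {f} := hf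
  exact Finite.of_equiv (AdjoinRoot f) (Ideal.quotEquivOfEq e.symm).toEquiv

/-- The degree `[F_v : F]` of a finite place `v` of `F(t)`. -/
def placeDeg (v : HeightOneSpectrum F[X]) : ℕ := Module.finrank F (ResField v)

variable (F) in
/-- The places of `F(t)` other than `0` and `∞` whose degree divides `a`. The place `∞` is not a
prime ideal of `F[t]`, and the place `0` is the ideal generated by `t`. -/
def placesDvd (a : ℕ) : Set (HeightOneSpectrum F[X]) :=
  {v | v.asIdeal ≠ Ideal.span {X} ∧ placeDeg v ∣ a}

/-- The class of `t` in `F_v`. Viewed in an algebraic closure of `F` it is one of the points of the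
Galois orbit `v`, that is, a root of the monic irreducible polynomial generating `v`. -/
def placeRep (v : HeightOneSpectrum F[X]) : ResField v := Ideal.Quotient.mk v.asIdeal X

/-- The additive character `x ↦ ψ (Tr_{F_v / F} (β x))` of `F_v`. -/
def placeChar {R : Type*} [CommRing R] (ψ : AddChar F R) (v : HeightOneSpectrum F[X])
    (β : ResField v) : AddChar (ResField v) R :=
  ψ.compAddMonoidHom
    ((Algebra.trace F (ResField v)).toAddMonoidHom.comp (AddMonoidHom.mulLeft β))

variable [Finite F]

/-- The Kloosterman sum `Kl_γ(v)` attached to the place `v`: the sum over `F_v` with parameter `γ`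
and with the character `x ↦ ψ (Tr (β_v x))`, where `β_v ∈ F_v` is a point of the orbit `v`. -/
def placeKloosterman {R : Type*} [CommRing R] (ψ : AddChar F R) (γ : Fˣ)
    (v : HeightOneSpectrum F[X]) : R :=
  kloostermanSum (placeChar ψ v (placeRep v)) (algebraMap F (ResField v) γ)

/-- The Kloosterman angle `θ_γ(v) ∈ [0, π]`, with `ι (Kl_γ(v)) = 2 q^{deg v / 2} cos θ_γ(v)`,
where `q = |F|`. -/
def kloostermanAngle (ψ : AddChar F (AlgebraicClosure ℚ)) (ι : AlgebraicClosure ℚ →+* ℂ) (γ : Fˣ)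
    (v : HeightOneSpectrum F[X]) : ℝ :=
  Real.arccos ((ι (placeKloosterman ψ γ v)).re / (2 * (Nat.card F : ℝ) ^ ((placeDeg v : ℝ) / 2)))

/-- The measure `μ_a`: the average of the Dirac masses at the angles `θ_γ(v)`,
for `v` of degree dividing `a`. -/
def kloostermanAngleMeasure (ψ : AddChar F (AlgebraicClosure ℚ)) (ι : AlgebraicClosure ℚ →+* ℂ)
    (γ : Fˣ) (a : ℕ) : Measure ℝ :=
  (Nat.card (placesDvd F a) : ENNReal)⁻¹ •
    Measure.sum fun v : placesDvd F a => Measure.dirac (kloostermanAngle ψ ι γ v)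

end Places

end

noncomputable section

/-! ### Counting square values of a polynomial over a finite field -/

/-! With `Q = q ^ deg v`, both gaps come from Liouville's inequality in the `p`-th cyclotomic field,
of degree `p - 1`. The Kloosterman sum `κ` is an algebraic integer there, congruent to `1` modulo a
prime above `p`, while `Q` is congruent to `0`; so neither `κ` nor `4 * Q - κ ^ 2` vanishes
(`kloostermanSum_ne_zero_and_sq_ne`). The conjugates of `κ` are again Kloosterman sums, so the Weil
bound puts all conjugates of both numbers below `4 * Q`, and `one_le_norm_mul_pow` bounds both from
below by `(4 * Q) ^ (-(p - 2))`. They control `|cos θ|` and `sin θ ^ 2`, hence the distance from `θ`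
to `0`, `π / 2` and `π`.

The Weil bound is proved by elementary means. Stepanov's method (`card_isSquare_eval_le`) bounds
below the number of points on `y ^ Q - y = x + γ / x` over a large extension `K`, which bounds above
the sum over all nontrivial characters of the Kloosterman sums over `K`. Along quadratic extensions
the normalised sums obey `x ↦ x ^ 2 - 2` (`kloostermanSum_quadraticAlgebra`). They therefore stay at
least `-2`, so a one-sided estimate suffices: a sum violating the bound would grow without limit,
with nothing to cancel it. -/

lemma eq_zero_of_sq_eq_sq_mul_squarefree {R : Type*} [CommRing R] [IsDomain R]
    [UniqueFactorizationMonoid R] {a b f : R} (hf : Squarefree f)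
    (hf0 : f ≠ 0) (hfu : ¬ IsUnit f) (h : a ^ 2 = b ^ 2 * f) : b = 0 := by
  classical
  let _ := UniqueFactorizationMonoid.strongNormalizationMonoid (α := R)
  by_contra hb
  obtain ⟨P, hP, hPf⟩ := WfDvdMonoid.exists_irreducible_factor hfu hf0
  obtain ⟨P', hP', hPP'⟩ :=
    UniqueFactorizationMonoid.exists_mem_normalizedFactors_of_dvd hf0 hP hPf
  have h1 : (UniqueFactorizationMonoid.normalizedFactors f).count P' = 1 :=
    Multiset.count_eq_one_of_mem
      ((UniqueFactorizationMonoid.squarefree_iff_nodup_normalizedFactors hf0).1 hf) hP'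
  -- The multiplicity of `P'` is even on the left and odd on the right.
  have h2 := congrArg (fun x => (UniqueFactorizationMonoid.normalizedFactors x).count P') h
  simp only [UniqueFactorizationMonoid.normalizedFactors_mul (pow_ne_zero 2 hb) hf0,
    UniqueFactorizationMonoid.normalizedFactors_pow, Multiset.count_add, Multiset.count_nsmul,
    h1] at h2
  omega

/-- Dimension count: there are `2 * (J * (A + 1))` free coefficients, and the combination has degree
below `J + r * A + G.natDegree`. -/
lemma exists_auxiliary_polynomials {K : Type*} [Field K] (r A J : ℕ) (G : K[X])
    (hlt : J + r * A + G.natDegree < 2 * (J * (A + 1))) :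
    ∃ a b : Fin J → K[X], (∀ j, (a j).natDegree ≤ A) ∧ (∀ j, (b j).natDegree ≤ A) ∧
      (∃ j, a j ≠ 0 ∨ b j ≠ 0) ∧
      ∑ j : Fin J, X ^ (j : ℕ) * (expand K r (a j) + expand K r (b j) * G) = 0 := by
  let L₀ : (Fin J → degreeLT K (A + 1)) × (Fin J → degreeLT K (A + 1)) →ₗ[K] K[X] :=
    { toFun := fun v => ∑ j : Fin J, X ^ (j : ℕ) *
        (expand K r (v.1 j : K[X]) + expand K r (v.2 j : K[X]) * G)
      map_add' := fun v w => by
        rw [← Finset.sum_add_distrib]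
        refine Finset.sum_congr rfl fun j _ => ?_
        simp only [Prod.fst_add, Prod.snd_add, Pi.add_apply, Submodule.coe_add, map_add]
        ring
      map_smul' := fun c v => by
        rw [RingHom.id_apply, Finset.smul_sum]
        refine Finset.sum_congr rfl fun j _ => ?_
        simp only [Prod.smul_fst, Prod.smul_snd, Pi.smul_apply, Submodule.coe_smul, map_smul]
        simp only [smul_eq_C_mul]
        ring }
  have hdeg : ∀ q : degreeLT K (A + 1), (q : K[X]).natDegree ≤ A := fun q => by
    have := mem_degreeLT.1 q.2
    exact natDegree_le_of_degree_le (by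
      rw [degree_le_iff_coeff_zero]
      intro m hm
      refine coeff_eq_zero_of_degree_lt (this.trans_le ?_)
      exact_mod_cast Nat.succ_le_of_lt (by exact_mod_cast hm))
  have hmem : ∀ v, L₀ v ∈ degreeLT K (J + r * A + G.natDegree) := fun v => by
    change ∑ j : Fin J, X ^ (j : ℕ) *
        (expand K r (v.1 j : K[X]) + expand K r (v.2 j : K[X]) * G) ∈ _
    refine Submodule.sum_mem _ fun j _ => mem_degreeLT.2 ?_
    refine lt_of_le_of_lt degree_le_natDegree ?_
    have hj := j.2
    have e1 : (expand K r (v.1 j : K[X])).natDegree ≤ r * A := by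
      rw [natDegree_expand, mul_comm]; exact Nat.mul_le_mul_left _ (hdeg _)
    have e2 : (expand K r (v.2 j : K[X])).natDegree ≤ r * A := by
      rw [natDegree_expand, mul_comm]; exact Nat.mul_le_mul_left _ (hdeg _)
    have e3 : (expand K r (v.1 j : K[X]) + expand K r (v.2 j : K[X]) * G).natDegree
        ≤ r * A + G.natDegree :=
      natDegree_add_le_of_degree_le (e1.trans (Nat.le_add_right _ _))
        (natDegree_mul_le.trans (Nat.add_le_add_right e2 _))
    have e4 : (X ^ (j : ℕ) * (expand K r (v.1 j : K[X]) +
        expand K r (v.2 j : K[X]) * G)).natDegree ≤ j + (r * A + G.natDegree) :=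
      natDegree_mul_le.trans (Nat.add_le_add (natDegree_X_pow_le _) e3)
    exact_mod_cast (by omega : _ < J + r * A + G.natDegree)
  let L := L₀.codRestrict _ hmem
  have hrank : ∀ n, Module.finrank K (degreeLT K n) = n := fun n => by
    rw [(degreeLTEquiv K n).finrank_eq]; simp
  have : ∀ n, FiniteDimensional K (degreeLT K n) := fun n =>
    Module.Finite.equiv (degreeLTEquiv K n).symm
  have hker : LinearMap.ker L ≠ ⊥ := by
    refine LinearMap.ker_ne_bot_of_finrank_lt ?_
    rw [hrank, Module.finrank_prod, Module.finrank_pi_fintype]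
    simp only [hrank, Finset.sum_const, Finset.card_univ, Fintype.card_fin, smul_eq_mul]
    omega
  obtain ⟨v, hv, hv0⟩ := (Submodule.ne_bot_iff _).1 hker
  refine ⟨fun j => v.1 j, fun j => v.2 j, fun j => hdeg _, fun j => hdeg _, ?_, ?_⟩
  · by_contra! hcon
    exact hv0 (Prod.ext (funext fun j => Subtype.ext (hcon j).1)
      (funext fun j => Subtype.ext (hcon j).2))
  · exact congrArg Subtype.val (LinearMap.mem_ker.1 hv)

/-- Nonvanishing step of Stepanov's method. The lowest nonzero block would be divisible by `X ^ (p ^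
e)`; multiplying by its conjugate removes the half-power of `f`, and the degrees are too small for a
mere congruence. -/
lemma forall_eq_zero_of_sum_X_pow_mul_eq_zero {K : Type*} [Field K] (p e s J A : ℕ)
    [Fact p.Prime] [CharP K p] (hr : p ^ e = 2 * s + 1) {f : K[X]} (hf : Squarefree f)
    (hdeg : f.natDegree ≠ 0) (h0 : f.coeff 0 ≠ 0) (hA : 2 * A + f.natDegree < p ^ e)
    (a b : Fin J → K[X]) (ha : ∀ j, (a j).natDegree ≤ A) (hb : ∀ j, (b j).natDegree ≤ A)
    (h : ∑ j : Fin J, X ^ ((j : ℕ) * p ^ e) * (a j + b j * f ^ (s + 1)) = 0) :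
    ∀ j, a j = 0 ∧ b j = 0 := by
  have key : ∀ α β : K[X], α.natDegree ≤ A → β.natDegree ≤ A →
      X ^ (p ^ e) ∣ α + β * f ^ (s + 1) → α = 0 ∧ β = 0 := by
    intro α β hα hβ hdvd
    set φ := iterateFrobenius K p e
    have hpow : f ^ (p ^ e) = expand K (p ^ e) (f.map φ) := by
      rw [← map_iterateFrobenius_expand, map_expand]
    obtain ⟨g, hg⟩ : X ^ (p ^ e) ∣ f ^ (p ^ e) - C (φ (f.coeff 0)) := by
      have h1 : X ∣ f.map φ - C (φ (f.coeff 0)) := by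
        rw [X_dvd_iff]; simp
      obtain ⟨g, hg⟩ := h1
      refine ⟨expand K (p ^ e) g, ?_⟩
      have := congrArg (expand K (p ^ e)) hg
      rwa [map_sub, map_mul, expand_X, expand_C, ← hpow] at this
    have hc : φ (f.coeff 0) ≠ 0 := by
      rw [iterateFrobenius_def]; exact pow_ne_zero _ h0
    -- `f ^ (2 * s + 2) = f ^ (p ^ e) * f`, and `f ^ (p ^ e)` is a polynomial in `X ^ (p ^ e)`, so
    -- it reduces to its constant term.
    have h2 : X ^ (p ^ e) ∣ α ^ 2 - β ^ 2 * (C (φ (f.coeff 0)) * f) := by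
      obtain ⟨u, hu⟩ := hdvd
      refine ⟨u * (α - β * f ^ (s + 1)) + β ^ 2 * f * g, ?_⟩
      have e1 : f ^ (p ^ e) * f = f ^ (s + 1) * f ^ (s + 1) := by
        rw [hr]; ring
      linear_combination (α - β * f ^ (s + 1)) * hu + (β ^ 2 * f) * hg - β ^ 2 * e1
    have h3 : α ^ 2 - β ^ 2 * (C (φ (f.coeff 0)) * f) = 0 := by
      by_contra hne
      have := natDegree_le_of_dvd h2 hne
      rw [natDegree_X_pow] at this
      have d1 : (α ^ 2).natDegree ≤ 2 * A + f.natDegree :=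
        (natDegree_pow_le.trans (Nat.mul_le_mul_left 2 hα)).trans (Nat.le_add_right _ _)
      have d2 : (β ^ 2 * (C (φ (f.coeff 0)) * f)).natDegree ≤ 2 * A + f.natDegree :=
        natDegree_mul_le.trans (Nat.add_le_add
          (natDegree_pow_le.trans (Nat.mul_le_mul_left 2 hβ)) (natDegree_C_mul_le _ _))
      have := (natDegree_sub_le_of_le d1 d2)
      simp only [max_self] at this
      omega
    have hu : IsUnit (C (φ (f.coeff 0))) := isUnit_C.2 hc.isUnit
    have hβ0 : β = 0 := by
      refine eq_zero_of_sq_eq_sq_mul_squarefree (f := C (φ (f.coeff 0)) * f) ?_ ?_ ?_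
        (sub_eq_zero.1 h3)
      · exact ((associated_unit_mul_left f _ hu).squarefree_iff).2 hf
      · exact mul_ne_zero (C_ne_zero.2 hc) hf.ne_zero
      · intro hun
        exact hdeg (natDegree_eq_zero_of_isUnit (isUnit_of_mul_isUnit_right hun))
    subst hβ0
    refine ⟨?_, rfl⟩
    simpa using h3
  have main : ∀ n : ℕ, ∀ j : Fin J, (j : ℕ) = n → a j = 0 ∧ b j = 0 := by
    intro n
    induction n using Nat.strong_induction_on with
    | _ n ih =>
      intro j hj
      refine key _ _ (ha j) (hb j) ?_
      have h1 : X ^ (n * p ^ e) * (a j + b j * f ^ (s + 1)) +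
          ∑ i ∈ Finset.univ.erase j, X ^ ((i : ℕ) * p ^ e) * (a i + b i * f ^ (s + 1)) = 0 := by
        rw [← hj, ← h, ← Finset.add_sum_erase _ _ (Finset.mem_univ j)]
      have h2 : X ^ (n * p ^ e) * X ^ (p ^ e) ∣
          ∑ i ∈ Finset.univ.erase j, X ^ ((i : ℕ) * p ^ e) * (a i + b i * f ^ (s + 1)) := by
        refine Finset.dvd_sum fun i hi => ?_
        rcases lt_trichotomy (i : ℕ) n with hlt | heq | hgt
        · rw [(ih _ hlt i rfl).1, (ih _ hlt i rfl).2]; simp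
        · exact absurd (Fin.ext (heq.trans hj.symm)) (Finset.ne_of_mem_erase hi)
        · rw [← pow_add]
          refine Dvd.dvd.mul_right (pow_dvd_pow _ ?_) _
          calc n * p ^ e + p ^ e = (n + 1) * p ^ e := by ring
            _ ≤ i * p ^ e := Nat.mul_le_mul_right _ hgt
      have h3 : X ^ (n * p ^ e) * X ^ (p ^ e) ∣ X ^ (n * p ^ e) * (a j + b j * f ^ (s + 1)) := by
        rw [eq_neg_of_add_eq_zero_left h1]; exact (dvd_neg).2 h2
      exact (mul_dvd_mul_iff_left (pow_ne_zero _ X_ne_zero)).1 h3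
  exact fun j => main j j rfl

/-- Stepanov's method without derivatives: over a field of order `r ^ 2`, the `r`-power map is an
involution. It carries the values of `H` at the points in question to values of an identically zero
combination, so these points are roots of the nonzero polynomial `H`. -/
theorem card_isSquare_eval_le {K : Type*} [Field K] [Fintype K] (p e s μ : ℕ) [Fact p.Prime]
    [CharP K p] (hr : p ^ e = 2 * s + 1) (hK : Fintype.card K = (p ^ e) ^ 2) {f : K[X]}
    (hf : Squarefree f) (hμ : f.natDegree ≤ 2 * μ) (hdeg : f.natDegree ≠ 0)
    (h0 : f.coeff 0 ≠ 0) (hlarge : 2 * μ * (μ + 1) < p ^ e) :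
    Nat.card {y : K // IsSquare (f.eval y)} ≤ 2 * s ^ 2 + 2 * s + 2 * μ * (2 * s + 1) := by
  classical
  have hμs : μ ≤ s := by nlinarith
  obtain ⟨A, rfl⟩ := Nat.exists_eq_add_of_le hμs
  -- With `A = s - μ` and `J = s + 1 + μ`, unknowns outnumber equations exactly when `2 * μ * (μ +
  -- 1) < p ^ e`, and the degree bound for `H` is the claimed count.
  set J := (μ + A) + 1 + μ with hJ
  have hG : (f ^ (μ + A + 1)).natDegree ≤ 2 * μ * (μ + A + 1) := by
    refine natDegree_pow_le.trans ?_
    rw [mul_comm]; exact Nat.mul_le_mul_right _ hμ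
  obtain ⟨a, b, ha, hb, ⟨j₀, hj₀⟩, hab⟩ := exists_auxiliary_polynomials (p ^ e) A J
    (f ^ (μ + A + 1)) (by
      refine lt_of_le_of_lt (Nat.add_le_add_left hG _) ?_
      rw [hr] at hlarge ⊢
      rw [hJ]
      nlinarith)
  set φ := iterateFrobenius K p e
  have hφ : ∀ x, φ x = x ^ (p ^ e) := fun x => iterateFrobenius_def p e x
  set H : K[X] := ∑ j : Fin J, X ^ ((j : ℕ) * p ^ e) *
    ((a j).map φ + (b j).map φ * f ^ (μ + A + 1)) with hH
  have hH0 : H ≠ 0 := by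
    intro hzero
    have := forall_eq_zero_of_sum_X_pow_mul_eq_zero p e (μ + A) J A hr hf hdeg h0 (by omega)
      (fun j => (a j).map φ) (fun j => (b j).map φ) (fun j => natDegree_map_le.trans (ha j))
      (fun j => natDegree_map_le.trans (hb j)) hzero j₀
    simp only [Polynomial.map_eq_zero] at this
    tauto
  have hcard : ∀ y : K, y ^ (p ^ e * p ^ e) = y := fun y => by
    rw [← sq, ← hK]; exact FiniteField.pow_card y
  have hroot : ∀ y : K, IsSquare (f.eval y) → H.eval y = 0 := by
    rintro y ⟨w, hw⟩
    have h1 : φ (H.eval y) = 0 := by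
      have h2 := congrArg (Polynomial.eval y) hab
      rw [eval_zero, eval_finsetSum] at h2
      rw [hH, eval_finsetSum, map_sum, ← h2]
      refine Finset.sum_congr rfl fun j _ => ?_
      have hφφ : φ.comp φ = RingHom.id K := RingHom.ext fun x => by
        rw [RingHom.comp_apply, hφ, hφ, ← pow_mul, hcard, RingHom.id_apply]
      have hm : ∀ g : K[X], φ ((g.map φ).eval y) = (expand K (p ^ e) g).eval y := fun g => by
        rw [← eval_map_apply, Polynomial.map_map, hφφ, Polynomial.map_id, hφ, expand_eval]
      simp only [eval_mul, eval_add, eval_pow, eval_X, map_mul, map_add, hm]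
      congr 1
      · rw [hφ, ← pow_mul, mul_assoc, mul_comm, pow_mul, hcard]
      · congr 2
        -- The only use of squareness: if `f(y) = w ^ 2` and `r = p ^ e`, then `f(y) ^ ((s + 1) * r)
        -- = w ^ (r ^ 2 + r) = w ^ (r + 1) = f(y) ^ (s + 1)`.
        rw [hw, hφ, ← sq, ← pow_mul, ← pow_mul, ← pow_mul,
          show 2 * ((μ + A + 1) * p ^ e) = p ^ e * p ^ e + p ^ e by rw [hr]; ring, pow_add, hcard,
          ← pow_succ', hr]
        ring
    exact (map_eq_zero φ).1 h1
  have hHdeg : H.natDegree ≤ (J - 1) * p ^ e + (A + 2 * μ * (μ + A + 1)) := by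
    refine natDegree_sum_le_of_forall_le _ _ fun j _ => ?_
    refine natDegree_mul_le.trans (Nat.add_le_add ?_ ?_)
    · rw [natDegree_X_pow]
      exact Nat.mul_le_mul_right _ (Nat.le_sub_one_of_lt j.2)
    · refine natDegree_add_le_of_degree_le
        ((natDegree_map_le.trans (ha j)).trans (Nat.le_add_right _ _)) ?_
      exact natDegree_mul_le.trans (Nat.add_le_add (natDegree_map_le.trans (hb j)) hG)
  have hle : Nat.card {y : K // IsSquare (f.eval y)} ≤ H.natDegree := by
    rw [Nat.card_eq_fintype_card, Fintype.card_subtype]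
    refine le_trans (Finset.card_le_card (t := H.roots.toFinset) fun y hy => ?_)
      ((Multiset.toFinset_card_le _).trans (card_roots' H))
    rw [Multiset.mem_toFinset, mem_roots hH0]
    exact hroot y (Finset.mem_filter.1 hy).2
  refine hle.trans (hHdeg.trans ?_)
  rw [hr, hJ, show μ + A + 1 + μ - 1 = μ + A + μ by omega]
  nlinarith

/-! ### Kloosterman sums over a quadratic extension -/

lemma kloostermanSum_eq {k R : Type*} [Field k] [Fintype k] [DecidableEq k] [CommRing R]
    (ψ : AddChar k R) (α : k) :
    kloostermanSum ψ α = -∑ x : k, if x = 0 then 0 else ψ (x + α / x) := by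
  rw [kloostermanSum, neg_inj]
  rw [Finset.sum_ite, Finset.sum_const_zero, zero_add]
  refine Finset.sum_bij (fun (x : kˣ) _ => (x : k)) (by simp) (fun x _ y _ h => Units.ext h)
    (fun x hx => ⟨Units.mk0 x (by simpa using hx), by simp⟩) (fun x _ => rfl)

/-- Each `w` is hit `1 + χ w` times by `v ^ 2` and `1 - χ w` times by `a * v ^ 2`, with `χ` the
quadratic character. -/
lemma sum_sq_add_sum_nonsquare_mul_sq {k M : Type*} [Field k] [Fintype k]
    [CommRing M] (hk : ringChar k ≠ 2) {a : k} (ha : ¬ IsSquare a) (G : k → M) :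
    ∑ v, (G (v ^ 2) + G (a * v ^ 2)) = 2 * ∑ w, G w := by
  classical
  have ha0 : a ≠ 0 := by rintro rfl; exact ha (IsSquare.zero)
  have key : ∀ H : k → M, ∑ v, H (v ^ 2) = ∑ w, ((quadraticChar k w + 1 : ℤ) : M) * H w := by
    intro H
    rw [← Finset.sum_fiberwise (s := Finset.univ) (g := fun v : k => v ^ 2)]
    refine Finset.sum_congr rfl fun w _ => ?_
    rw [← quadraticChar_card_sqrts hk w, Finset.sum_congr rfl (g := fun _ => H w)
      (by intro v hv; rw [(Finset.mem_filter.1 hv).2]), Finset.sum_const, nsmul_eq_mul]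
    congr 2
    rw [Int.cast_natCast]
    congr 2
    ext v
    simp
  rw [Finset.sum_add_distrib, key, key (fun w => G (a * w)),
    ← Equiv.sum_comp (Equiv.mulLeft₀ a ha0) (fun w => ((quadraticChar k w + 1 : ℤ) : M) * G w),
    ← Equiv.sum_comp (Equiv.mulLeft₀ a ha0) G, ← Finset.sum_add_distrib, Finset.mul_sum]
  refine Finset.sum_congr rfl fun w _ => ?_
  simp only [Equiv.mulLeft₀_apply, map_mul, quadraticChar_neg_one_iff_not_isSquare.2 ha]
  push_cast
  ring

lemma QuadraticAlgebra.algebra_trace_eq {k : Type*} [Field k] (a : k)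
    (z : QuadraticAlgebra k a 0) : Algebra.trace k (QuadraticAlgebra k a 0) z = 2 * z.re := by
  rw [Algebra.trace_eq_matrix_trace (QuadraticAlgebra.basis a 0), Matrix.trace_fin_two,
    Algebra.leftMulMatrix_eq_repr_mul, Algebra.leftMulMatrix_eq_repr_mul]
  have h0 : QuadraticAlgebra.basis a 0 0 = (⟨1, 0⟩ : QuadraticAlgebra k a 0) := by
    simp [QuadraticAlgebra.basis, Module.Basis.ofEquivFun]
  have h1 : QuadraticAlgebra.basis a 0 1 = (⟨0, 1⟩ : QuadraticAlgebra k a 0) := by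
    simp [QuadraticAlgebra.basis, Module.Basis.ofEquivFun]
  rw [h0, h1]
  simp
  ring

/-- For fixed `n ≠ 0` the argument is linear in `u`, and its slope vanishes only at `n = -γ`. -/
lemma sum_addChar_mul_one_add_div {k R : Type*} [Field k] [Fintype k] [DecidableEq k]
    [CommRing R] [IsDomain R] (hk : ringChar k ≠ 2) {ψ : AddChar k R} (hψ : ψ ≠ 1) {γ : k}
    (hγ : γ ≠ 0) :
    ∑ u : k, ∑ n : k, (if n = 0 then 0 else ψ (2 * u + γ * (2 * u) / n)) = Fintype.card k := by
  have h2 : (2 : k) ≠ 0 := Ring.two_ne_zero hk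
  rw [Finset.sum_comm]
  have h : ∀ n : k, ∑ u : k, (if n = 0 then 0 else ψ (2 * u + γ * (2 * u) / n)) =
      if n = -γ then (Fintype.card k : R) else 0 := by
    intro n
    by_cases hn : n = 0
    · subst hn
      simp [eq_comm (a := (0 : k)), hγ]
    have e : ∀ u : k, 2 * u + γ * (2 * u) / n = u * (2 * (n + γ) / n) := fun u => by
      field_simp
    simp only [hn, if_false, e]
    rw [AddChar.sum_mulShift _ (AddChar.IsPrimitive.of_ne_one hψ)]
    have : 2 * (n + γ) / n = 0 ↔ n = -γ := by
      simp [hn, h2, eq_neg_iff_add_eq_zero]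
    simp [this]
  simp [h]

/-- The summand depends only on the trace `2 * u` and the norm `n`. The square of the sum over `k`
runs over split norms `u ^ 2 - v ^ 2`, the sum over the extension over `u ^ 2 - a * v ^ 2`; together
they cover each `n` twice. -/
theorem kloostermanSum_quadraticAlgebra {k R : Type*} [Field k] [Fintype k] [CommRing R]
    [IsDomain R] (hk : ringChar k ≠ 2) {a : k} [Fact (∀ r, r ^ 2 ≠ a + 0 * r)]
    [Finite (QuadraticAlgebra k a 0)]
    {ψ : AddChar k R} (hψ : ψ ≠ 1) {γ : k} (hγ : γ ≠ 0) :
    kloostermanSum (ψ.compAddMonoidHom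
        (Algebra.trace k (QuadraticAlgebra k a 0)).toAddMonoidHom)
        (algebraMap k (QuadraticAlgebra k a 0) γ) =
      kloostermanSum ψ γ ^ 2 - 2 * Fintype.card k := by
  classical
  let _ := Fintype.ofFinite (QuadraticAlgebra k a 0)
  have ha : ¬ IsSquare a := fun ⟨r, hr⟩ =>
    (Fact.out : ∀ r, r ^ 2 ≠ a + 0 * r) r (by rw [hr]; ring)
  have h2 : (2 : k) ≠ 0 := Ring.two_ne_zero hk
  set F : k → k → R := fun u n => if n = 0 then 0 else ψ (2 * u + γ * (2 * u) / n) with hF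
  have hS2 : kloostermanSum (ψ.compAddMonoidHom
        (Algebra.trace k (QuadraticAlgebra k a 0)).toAddMonoidHom)
        (algebraMap k (QuadraticAlgebra k a 0) γ) =
      -∑ u : k, ∑ v : k, F u (u ^ 2 - a * v ^ 2) := by
    rw [kloostermanSum_eq, neg_inj, ← Fintype.sum_prod_type']
    refine Fintype.sum_equiv (QuadraticAlgebra.equivProd a 0) _ _ fun z => ?_
    have hn : z.norm = z.re ^ 2 - a * z.im ^ 2 := by
      rw [QuadraticAlgebra.norm_def]; ring
    change _ = F z.re (z.re ^ 2 - a * z.im ^ 2)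
    rw [← hn, hF]
    simp only [QuadraticAlgebra.norm_eq_zero_iff_eq_zero]
    split_ifs with hz
    · rfl
    · rw [AddChar.compAddMonoidHom_apply]
      congr 1
      change Algebra.trace k _ _ = _
      rw [map_add, QuadraticAlgebra.algebra_trace_eq, div_eq_mul_inv, ← Algebra.smul_def, map_smul,
        QuadraticAlgebra.algebra_trace_eq, QuadraticAlgebra.inv_def]
      simp
      field_simp
  have hS1 : kloostermanSum ψ γ ^ 2 = ∑ u : k, ∑ v : k, F u (u ^ 2 - v ^ 2) := by
    rw [kloostermanSum_eq, neg_sq, sq, Finset.sum_mul_sum, ← Fintype.sum_prod_type',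
      ← Fintype.sum_prod_type']
    symm
    refine Fintype.sum_equiv
      { toFun := fun z : k × k => (z.1 + z.2, z.1 - z.2)
        invFun := fun z => ((z.1 + z.2) / 2, (z.1 - z.2) / 2)
        left_inv := fun z => by ext <;> field_simp <;> ring
        right_inv := fun z => by ext <;> field_simp <;> ring } _ _ fun z => ?_
    simp only [Equiv.coe_fn_mk, hF]
    have e : z.1 ^ 2 - z.2 ^ 2 = (z.1 + z.2) * (z.1 - z.2) := by ring
    rw [e]
    by_cases h1 : z.1 + z.2 = 0
    · simp [h1]
    by_cases h3 : z.1 - z.2 = 0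
    · simp [h3]
    rw [if_neg (mul_ne_zero h1 h3), if_neg h1, if_neg h3, ← AddChar.map_add_eq_mul]
    congr 1
    field_simp
    ring
  have hsum : kloostermanSum ψ γ ^ 2 + ∑ u : k, ∑ v : k, F u (u ^ 2 - a * v ^ 2) =
      2 * Fintype.card k := by
    rw [hS1, ← Finset.sum_add_distrib, ← sum_addChar_mul_one_add_div hk hψ hγ, Finset.mul_sum]
    refine Finset.sum_congr rfl fun u _ => ?_
    rw [← Finset.sum_add_distrib,
      sum_sq_add_sum_nonsquare_mul_sq hk ha (fun w => F u (u ^ 2 - w))]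
    congr 1
    exact (Equiv.subLeft (u ^ 2)).sum_comp (F u)
  rw [hS2]
  linear_combination -hsum

/-- The value at the extension of degree `2 ^ j` of a Kloosterman sum with value `x` over a field
with `Q` elements. -/
def kloostermanTower (Q : ℕ) (x : ℂ) : ℕ → ℂ
  | 0 => x
  | j + 1 => kloostermanTower Q x j ^ 2 - 2 * (Q : ℂ) ^ 2 ^ j

lemma AddChar.compAddMonoidHom_ne_one {A B M : Type*} [AddGroup A] [AddGroup B] [CommMonoid M]
    {ψ : AddChar B M} (hψ : ψ ≠ 1) {f : A →+ B} (hf : Function.Surjective f) :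
    ψ.compAddMonoidHom f ≠ 1 := by
  obtain ⟨x, hx⟩ := AddChar.ne_one_iff.1 hψ
  obtain ⟨y, rfl⟩ := hf x
  exact AddChar.ne_one_iff.2 ⟨y, hx⟩

universe u in
-- Iterated quadratic extensions, glued by transitivity of the trace. One `K` serves all `ψ`, since
-- sums for different characters are later added over it.
theorem exists_extension_kloostermanSum_eq {k : Type u} [Field k] [Finite k]
    (hk : ringChar k ≠ 2) (j : ℕ) :
    ∃ (K : Type u) (_ : Field K) (_ : Finite K) (_ : Algebra k K),
      Nat.card K = Nat.card k ^ 2 ^ j ∧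
      ∀ ψ : AddChar k ℂ, ψ ≠ 1 → ∀ γ : k, γ ≠ 0 →
        kloostermanSum (ψ.compAddMonoidHom (Algebra.trace k K).toAddMonoidHom)
          (algebraMap k K γ) = kloostermanTower (Nat.card k) (kloostermanSum ψ γ) j := by
  induction j with
  | zero =>
    refine ⟨k, inferInstance, inferInstance, inferInstance, by simp, fun ψ _ γ _ => ?_⟩
    have : ψ.compAddMonoidHom (Algebra.trace k k).toAddMonoidHom = ψ := by
      ext x
      simp [AddChar.compAddMonoidHom_apply, Algebra.trace_self]
    rw [this]
    rfl
  | succ j ih =>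
    obtain ⟨K, _, _, _, hcard, hsum⟩ := ih
    have hK : ringChar K ≠ 2 := by rwa [← Algebra.ringChar_eq k K]
    obtain ⟨a, ha⟩ := FiniteField.exists_nonsquare hK
    have : Fact (∀ r, r ^ 2 ≠ a + 0 * r) :=
      ⟨fun r hr => ha ⟨r, by rw [← sq, hr]; ring⟩⟩
    have : Finite (QuadraticAlgebra K a 0) := Finite.of_equiv _ (QuadraticAlgebra.equivProd a 0).symm
    have : FiniteDimensional k K := Module.Finite.of_finite
    let _ := Fintype.ofFinite K
    refine ⟨QuadraticAlgebra K a 0, inferInstance, inferInstance, inferInstance, ?_,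
      fun ψ hψ γ hγ => ?_⟩
    · rw [Nat.card_congr (QuadraticAlgebra.equivProd a 0), Nat.card_prod, hcard]
      ring
    · have hγ' : algebraMap k K γ ≠ 0 := by simpa using hγ
      have := kloostermanSum_quadraticAlgebra hK (a := a) (AddChar.compAddMonoidHom_ne_one hψ
        (f := (Algebra.trace k K).toAddMonoidHom) (Algebra.trace_surjective k K)) hγ'
      rw [hsum ψ hψ γ hγ, ← Nat.card_eq_fintype_card, hcard] at this
      rw [kloostermanTower, IsScalarTower.algebraMap_apply k K (QuadraticAlgebra K a 0)]
      push_cast at this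
      rw [← this]
      congr 1
      ext z
      simp only [AddChar.compAddMonoidHom_apply]
      congr 1
      exact (Algebra.trace_trace (R := k) (S := K) z).symm

/-! ### The Weil bound for Kloosterman sums -/

lemma FiniteField.isSquare_mul_of_not_isSquare {K : Type*} [Field K] [Fintype K]
    {c d : K} (hc : ¬ IsSquare c) (hd : ¬ IsSquare d) : IsSquare (c * d) := by
  classical
  have hc0 : c ≠ 0 := by rintro rfl; exact hc IsSquare.zero
  have hd0 : d ≠ 0 := by rintro rfl; exact hd IsSquare.zero
  rw [← quadraticChar_one_iff_isSquare (mul_ne_zero hc0 hd0), map_mul,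
    quadraticChar_neg_one_iff_not_isSquare.2 hc, quadraticChar_neg_one_iff_not_isSquare.2 hd]
  norm_num

/-- As `Q = 0` in `K`, the derivative is `-2 * (X ^ Q - X)`, and modulo it the polynomial is the
unit `-4 * γ`. -/
lemma separable_artinSchreier_sq_sub {K : Type*} [Field K] (h2 : (2 : K) ≠ 0) {Q : ℕ}
    (hQ : (Q : K) = 0) {γ : K} (hγ : γ ≠ 0) :
    ((X ^ Q - X) ^ 2 - C (4 * γ) : K[X]).Separable := by
  have h1 : derivative ((X ^ Q - X) ^ 2 - C (4 * γ) : K[X]) = C (-2) * (X ^ Q - X) := by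
    simp [derivative_pow, hQ]
  rw [Polynomial.Separable, h1]
  refine ⟨C (-(4 * γ)⁻¹), C (-(8 * γ)⁻¹) * (X ^ Q - X), ?_⟩
  have h4 : (4 : K) ≠ 0 := by rw [show (4 : K) = 2 * 2 by norm_num]; exact mul_ne_zero h2 h2
  have h8 : (8 : K) ≠ 0 := by rw [show (8 : K) = 2 * 4 by norm_num]; exact mul_ne_zero h2 h4
  have e1 : (C (-(4 * γ)⁻¹) * C (4 * γ) : K[X]) = -1 := by
    rw [← C_mul, neg_mul, inv_mul_cancel₀ (mul_ne_zero h4 hγ)]; simp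
  have e2 : (C (-(8 * γ)⁻¹) * C (-2) : K[X]) = - C (-(4 * γ)⁻¹) := by
    rw [← C_mul, ← C_neg]
    congr 1
    field_simp
    norm_num
  linear_combination (X ^ Q - X) ^ 2 * e2 - e1

lemma natDegree_artinSchreier_sq_sub {K : Type*} [Field K] {Q : ℕ} (hQ : 1 < Q) (γ : K) :
    ((X ^ Q - X) ^ 2 - C γ : K[X]).natDegree = 2 * Q := by
  have h : (X ^ Q - X : K[X]).natDegree = Q := FiniteField.X_pow_card_sub_X_natDegree_eq K hQ
  rw [natDegree_sub_C, natDegree_pow, h]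

/-- The number of `y` for which `x + γ / x = y ^ Q - y` has two solutions `x`. -/
theorem sq_le_two_mul_card_square_artinSchreier {K : Type*} [Field K] [Fintype K] (p e s Q : ℕ)
    [Fact p.Prime] [CharP K p] (hr : p ^ e = 2 * s + 1) (hK : Fintype.card K = (p ^ e) ^ 2)
    (hQ1 : 1 < Q) (hQ : (Q : K) = 0) (h2 : (2 : K) ≠ 0) {γ : K} (hγ : γ ≠ 0)
    (hlarge : 2 * Q * (Q + 1) < p ^ e) :
    (p ^ e) ^ 2 ≤ 2 * Nat.card {y : K // (y ^ Q - y) ^ 2 - 4 * γ ≠ 0 ∧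
      IsSquare ((y ^ Q - y) ^ 2 - 4 * γ)} + 4 * Q * p ^ e := by
  classical
  have h4 : (4 : K) ≠ 0 := by rw [show (4 : K) = 2 * 2 by norm_num]; exact mul_ne_zero h2 h2
  have hchar : ringChar K ≠ 2 := fun h => by
    have := ringChar.charP K
    rw [h] at this
    exact h2 (CharP.cast_eq_zero K 2)
  obtain ⟨c, hc⟩ := FiniteField.exists_nonsquare hchar
  have hc0 : c ≠ 0 := by rintro rfl; exact hc IsSquare.zero
  -- Twisting by a nonsquare turns the upper bound on square values into a lower bound for the
  -- untwisted polynomial.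
  set f : K[X] := C c * ((X ^ Q - X) ^ 2 - C (4 * γ)) with hf
  have hdeg : f.natDegree = 2 * Q := by
    rw [hf, natDegree_C_mul hc0, natDegree_artinSchreier_sq_sub hQ1]
  have hsq : Squarefree f :=
    ((associated_unit_mul_left _ _ (isUnit_C.2 hc0.isUnit)).squarefree_iff).2
      (separable_artinSchreier_sq_sub h2 hQ hγ).squarefree
  have h0 : f.coeff 0 ≠ 0 := by
    rw [coeff_zero_eq_eval_zero, hf]
    simp [hc0, hγ, h4, (show Q ≠ 0 by omega)]
  have hT := card_isSquare_eval_le p e s Q hr hK hsq hdeg.le (by omega) h0 hlarge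
  have hcover : Fintype.card K ≤ Nat.card {y : K // IsSquare (f.eval y)} +
      Nat.card {y : K // (y ^ Q - y) ^ 2 - 4 * γ ≠ 0 ∧ IsSquare ((y ^ Q - y) ^ 2 - 4 * γ)} := by
    rw [Nat.card_eq_fintype_card, Nat.card_eq_fintype_card, Fintype.card_subtype,
      Fintype.card_subtype, ← Finset.card_univ]
    refine (Finset.card_le_card fun y _ => ?_).trans (Finset.card_union_le _ _)
    have he : f.eval y = c * ((y ^ Q - y) ^ 2 - 4 * γ) := by simp [hf]
    rw [Finset.mem_union, Finset.mem_filter, Finset.mem_filter, he]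
    by_cases hy0 : (y ^ Q - y) ^ 2 - 4 * γ = 0
    · left; exact ⟨Finset.mem_univ _, by rw [hy0, mul_zero]; exact IsSquare.zero⟩
    by_cases hys : IsSquare ((y ^ Q - y) ^ 2 - 4 * γ)
    · right; exact ⟨Finset.mem_univ _, hy0, hys⟩
    · left; exact ⟨Finset.mem_univ _, FiniteField.isSquare_mul_of_not_isSquare hc hys⟩
  rw [hK] at hcover
  rw [hr] at hcover ⊢
  nlinarith

lemma trace_pow_card {k K : Type*} [Field k] [Field K] [Fintype k] [Finite K]
    [Algebra k K] (y : K) : Algebra.trace k K (y ^ Fintype.card k) = Algebra.trace k K y := by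
  have : Algebra.IsAlgebraic k K := Algebra.IsAlgebraic.of_finite k K
  exact Algebra.trace_eq_of_algEquiv (FiniteField.frobeniusAlgEquivOfAlgebraic k K) y

/-- Double counting on `y ^ Q - y = x + γ / x`, where `Q` is the order of `k`: a nonzero square
discriminant gives two `x` over `y`, each `x` has at most `Q` such `y`, and `y ^ Q - y` has trace
zero. -/
lemma two_mul_card_le_card_mul_card_trace_eq_zero {k K : Type*} [Field k] [Field K] [Fintype k]
    [Fintype K] [Algebra k K] (h2 : (2 : K) ≠ 0) {γ : K} (hγ : γ ≠ 0) :
    2 * Nat.card {y : K // (y ^ Fintype.card k - y) ^ 2 - 4 * γ ≠ 0 ∧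
      IsSquare ((y ^ Fintype.card k - y) ^ 2 - 4 * γ)} ≤
    Fintype.card k * Nat.card {x : K // x ≠ 0 ∧ Algebra.trace k K (x + γ / x) = 0} := by
  classical
  rw [Nat.card_eq_fintype_card, Nat.card_eq_fintype_card, Fintype.card_subtype,
      Fintype.card_subtype, mul_comm, mul_comm (Fintype.card k)]
  refine Finset.card_mul_le_card_mul (fun y x : K => y ^ Fintype.card k - y = x + γ / x) ?_ ?_
  · intro y hy
    obtain ⟨-, hy0, w, hw⟩ := Finset.mem_filter.1 hy
    set h := y ^ Fintype.card k - y with hh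
    have hw0 : w ≠ 0 := by rintro rfl; exact hy0 (by rw [hw, mul_zero])
    have hprod : (h + w) / 2 * ((h - w) / 2) = γ := by
      field_simp
      linear_combination hw
    have hne1 : (h + w) / 2 ≠ 0 := left_ne_zero_of_mul (hprod ▸ hγ)
    have hne2 : (h - w) / 2 ≠ 0 := right_ne_zero_of_mul (hprod ▸ hγ)
    have htr : Algebra.trace k K h = 0 := by
      rw [hh, map_sub, trace_pow_card, sub_self]
    have hne : (h + w) / 2 ≠ (h - w) / 2 := by
      intro he
      apply hw0
      field_simp at he
      have : 2 * w = 0 := by linear_combination he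
      exact (mul_eq_zero.1 this).resolve_left h2
    rw [← Finset.card_pair hne]
    refine Finset.card_le_card fun x hx => ?_
    have hx' : x ≠ 0 ∧ h = x + γ / x := by
      rcases Finset.mem_insert.1 hx with rfl | hx
      · refine ⟨hne1, ?_⟩
        rw [← hprod, mul_div_cancel_left₀ _ hne1]
        field_simp; ring
      · rw [Finset.mem_singleton.1 hx]
        refine ⟨hne2, ?_⟩
        rw [← hprod, mul_div_cancel_right₀ _ hne2]
        field_simp; ring
    rw [Finset.mem_bipartiteAbove, Finset.mem_filter]
    exact ⟨⟨Finset.mem_univ _, hx'.1, hx'.2 ▸ htr⟩, hx'.2⟩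
  · intro x hx
    set q : K[X] := X ^ Fintype.card k - X - C (x + γ / x) with hq
    have hd : (X ^ Fintype.card k - X : K[X]).natDegree = Fintype.card k :=
      FiniteField.X_pow_card_sub_X_natDegree_eq K Fintype.one_lt_card
    have hqd : q.natDegree = Fintype.card k := by rw [hq, natDegree_sub_C, hd]
    have hq0 : q ≠ 0 := by
      rintro h
      rw [h, natDegree_zero] at hqd
      exact Fintype.card_ne_zero hqd.symm
    rw [← hqd]
    refine le_trans (Finset.card_le_card (t := q.roots.toFinset) fun y hy => ?_)
      ((Multiset.toFinset_card_le _).trans (card_roots' q))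
    rw [Finset.mem_bipartiteBelow] at hy
    rw [Multiset.mem_toFinset, mem_roots hq0, IsRoot, hq]
    have hy2 := hy.2
    rw [hqd] at hy2
    simp [hy2]

/-- Orthogonality over all `c`, with the trivial term `c = 0` removed. -/
lemma sum_kloostermanSum_mulShift {k K R : Type*} [Field k] [Field K] [Fintype k] [DecidableEq k]
    [Fintype K] [Algebra k K] [CommRing R] [IsDomain R] {ψ : AddChar k R} (hψ : ψ ≠ 1) (γ : K) :
    ∑ c ∈ Finset.univ.erase (0 : k), kloostermanSum ((AddChar.mulShift ψ c).compAddMonoidHom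
        (Algebra.trace k K).toAddMonoidHom) γ =
      (Fintype.card K - 1 : R) -
        Fintype.card k * Nat.card {x : K // x ≠ 0 ∧ Algebra.trace k K (x + γ / x) = 0} := by
  classical
  have h1 : ∀ c : k, kloostermanSum ((AddChar.mulShift ψ c).compAddMonoidHom
        (Algebra.trace k K).toAddMonoidHom) γ =
      -∑ x : K, if x = 0 then 0 else ψ (c * Algebra.trace k K (x + γ / x)) := fun c => by
    rw [kloostermanSum_eq]; rfl
  have h0 : kloostermanSum ((AddChar.mulShift ψ 0).compAddMonoidHom
        (Algebra.trace k K).toAddMonoidHom) γ = -(Fintype.card K - 1 : R) := by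
    rw [h1]
    simp only [zero_mul, AddChar.map_zero_eq_one]
    rw [Finset.sum_ite, Finset.sum_const_zero, zero_add, Finset.sum_const, nsmul_eq_mul, mul_one,
      Finset.filter_ne', Finset.card_erase_of_mem (Finset.mem_univ _), Finset.card_univ,
      Nat.cast_sub Fintype.card_pos, Nat.cast_one]
  have hall : ∑ c : k, kloostermanSum ((AddChar.mulShift ψ c).compAddMonoidHom
        (Algebra.trace k K).toAddMonoidHom) γ =
      -(Fintype.card k * Nat.card {x : K // x ≠ 0 ∧ Algebra.trace k K (x + γ / x) = 0} : R) := by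
    simp only [h1]
    rw [Finset.sum_neg_distrib, neg_inj, Finset.sum_comm]
    have h2 : ∀ x : K, ∑ c : k, (if x = 0 then 0 else ψ (c * Algebra.trace k K (x + γ / x))) =
        if x ≠ 0 ∧ Algebra.trace k K (x + γ / x) = 0 then (Fintype.card k : R) else 0 := by
      intro x
      by_cases hx : x = 0
      · simp [hx]
      simp only [hx, if_false, AddChar.sum_mulShift _ (AddChar.IsPrimitive.of_ne_one hψ)]
      simp [hx]
    simp only [h2]
    rw [Finset.sum_ite, Finset.sum_const_zero, add_zero, Finset.sum_const, nsmul_eq_mul,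
      Nat.card_eq_fintype_card, Fintype.card_subtype, mul_comm]
  rw [← Finset.add_sum_erase _ _ (Finset.mem_univ (0 : k)), h0] at hall
  linear_combination hall

lemma exists_real_kloostermanSum_eq {k : Type*} [Field k] [Finite k] (ψ : AddChar k ℂ) (γ : k) :
    ∃ x : ℝ, kloostermanSum ψ γ = x := by
  classical
  let _ := Fintype.ofFinite k
  refine ⟨(kloostermanSum ψ γ).re, (Complex.conj_eq_iff_re.1 ?_).symm⟩
  rw [kloostermanSum_eq, map_neg, map_sum, neg_inj,
    ← Equiv.sum_comp (Equiv.neg k)]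
  refine Finset.sum_congr rfl fun x _ => ?_
  simp only [Equiv.neg_apply, neg_eq_zero, div_neg]
  split_ifs
  · simp
  · rw [← AddChar.map_neg_eq_conj]
    congr 1
    ring

/-- The sequence obtained by iterating `x ↦ x ^ 2 - 2`. -/
def chebyshevIterate (u : ℝ) : ℕ → ℝ
  | 0 => u
  | j + 1 => chebyshevIterate u j ^ 2 - 2

lemma chebyshevIterate_succ_ge (u : ℝ) (j : ℕ) : -2 ≤ chebyshevIterate u (j + 1) := by
  rw [chebyshevIterate]; nlinarith [sq_nonneg (chebyshevIterate u j)]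

/-- For `d ≥ 0` the map sends `2 + d` to at least `2 + 4 * d`. Indices start at `1` because `u` may
be negative. -/
lemma exists_linear_le_chebyshevIterate {u : ℝ} (hu : 2 < |u|) :
    ∃ δ > 0, ∀ j : ℕ, 2 + (j + 1) * δ ≤ chebyshevIterate u (j + 1) := by
  have h1 : 4 < u ^ 2 := by nlinarith [sq_abs u]
  refine ⟨u ^ 2 - 4, by linarith, fun j => ?_⟩
  induction j with
  | zero => simp only [chebyshevIterate]; push_cast; linarith
  | succ j ih =>
    rw [chebyshevIterate]
    push_cast
    have hj : (0 : ℝ) ≤ (j + 1) * (u ^ 2 - 4) := by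
      have : (0 : ℝ) ≤ u ^ 2 - 4 := by linarith
      positivity
    have hj' : (0 : ℝ) ≤ j * (u ^ 2 - 4) := by
      have : (0 : ℝ) ≤ u ^ 2 - 4 := by linarith
      positivity
    nlinarith

lemma kloostermanTower_ofReal (Q : ℕ) (u : ℝ) (j : ℕ) :
    kloostermanTower Q ((√Q * u : ℝ) : ℂ) j = ((√Q ^ 2 ^ j * chebyshevIterate u j : ℝ) : ℂ) := by
  induction j with
  | zero => simp [kloostermanTower, chebyshevIterate]
  | succ j ih =>
    rw [kloostermanTower, chebyshevIterate, ih]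
    have h : ((√Q : ℝ) ^ 2 ^ (j + 1)) = (Q : ℝ) ^ 2 ^ j := by
      rw [pow_succ', pow_mul, Real.sq_sqrt (Nat.cast_nonneg Q)]
    have h' : ((√Q : ℝ) ^ 2 ^ j) ^ 2 = (Q : ℝ) ^ 2 ^ j := by
      rw [← pow_mul, mul_comm, pow_mul, Real.sq_sqrt (Nat.cast_nonneg Q)]
    rw [h]
    have : (√Q ^ 2 ^ j * chebyshevIterate u j) ^ 2 - 2 * (Q : ℝ) ^ 2 ^ j =
        (Q : ℝ) ^ 2 ^ j * (chebyshevIterate u j ^ 2 - 2) := by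
      rw [mul_pow, h']; ring
    rw [← this]
    push_cast
    ring

/-- The point count over an extension of order `r ^ 2`, `r = Q ^ 2 ^ j`, has error at most `4 * Q *
r`; dividing by `r` leaves a bound independent of `j`. -/
theorem sum_chebyshevIterate_le {k : Type*} [Field k] [Fintype k] [DecidableEq k]
    (hk : ringChar k ≠ 2) {ψ : AddChar k ℂ} (hψ : ψ ≠ 1) {γ : k} (hγ : γ ≠ 0) (u : k → ℝ)
    (hu : ∀ c, kloostermanSum (AddChar.mulShift ψ c) γ = ((√(Fintype.card k) * u c : ℝ) : ℂ))
    (j : ℕ) (hj : 2 * Fintype.card k * (Fintype.card k + 1) < Fintype.card k ^ 2 ^ j) :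
    ∑ c ∈ Finset.univ.erase (0 : k), chebyshevIterate (u c) (j + 1) ≤ 4 * Fintype.card k := by
  obtain ⟨K, _, _, _, hcard, hsum⟩ := exists_extension_kloostermanSum_eq hk (j + 1)
  let _ := Fintype.ofFinite K
  obtain ⟨p, hp⟩ := CharP.exists k
  obtain ⟨n, hprime, hn⟩ := FiniteField.card k p
  have : Fact p.Prime := ⟨hprime⟩
  have : CharP K p := charP_of_injective_algebraMap (algebraMap k K).injective p
  set Q := Fintype.card k with hQ
  have hp2 : p ≠ 2 := fun h => hk (by rw [ringChar.eq k p, h])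
  have hQ1 : 1 < Q := Fintype.one_lt_card
  have hQK : (Q : K) = 0 := by
    rw [← map_natCast (algebraMap k K), hQ, FiniteField.cast_card_eq_zero, map_zero]
  have hK2 : (2 : K) ≠ 0 := by
    refine Ring.two_ne_zero ?_
    rwa [← Algebra.ringChar_eq k K]
  have hrQ : p ^ ((n : ℕ) * 2 ^ j) = Q ^ 2 ^ j := by rw [hn, pow_mul]
  obtain ⟨s, hs⟩ : Odd (p ^ ((n : ℕ) * 2 ^ j)) := (hprime.odd_of_ne_two hp2).pow
  have hγK : algebraMap k K γ ≠ 0 := by simpa using hγ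
  rw [Nat.card_eq_fintype_card (α := k), ← hQ] at hcard hsum
  have hcard' : Fintype.card K = (p ^ ((n : ℕ) * 2 ^ j)) ^ 2 := by
    rw [hrQ, ← Nat.card_eq_fintype_card, hcard]; ring
  have h1 := sq_le_two_mul_card_square_artinSchreier p _ s Q hs hcard' hQ1 hQK hK2 hγK
    (by rwa [hrQ])
  have h2 := two_mul_card_le_card_mul_card_trace_eq_zero (k := k) hK2 hγK
  have h3 := sum_kloostermanSum_mulShift (K := K) hψ (algebraMap k K γ)
  rw [← hQ] at h2 h3
  rw [hcard'] at h3
  rw [hrQ] at h1 h3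
  have h4 : ∀ c ∈ Finset.univ.erase (0 : k),
      kloostermanSum ((AddChar.mulShift ψ c).compAddMonoidHom
        (Algebra.trace k K).toAddMonoidHom) (algebraMap k K γ) =
      ((Q ^ 2 ^ j * chebyshevIterate (u c) (j + 1) : ℝ) : ℂ) := by
    intro c hc
    rw [hsum _ (AddChar.IsPrimitive.of_ne_one hψ (Finset.ne_of_mem_erase hc)) γ hγ, hu,
      kloostermanTower_ofReal Q, pow_succ', pow_mul, Real.sq_sqrt (Nat.cast_nonneg Q)]
  rw [Finset.sum_congr rfl h4, ← Complex.ofReal_sum, ← Finset.mul_sum] at h3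
  set S := ∑ c ∈ Finset.univ.erase (0 : k), chebyshevIterate (u c) (j + 1)
  set N := Nat.card {x : K // x ≠ 0 ∧ Algebra.trace k K (x + algebraMap k K γ / x) = 0}
  have h5 : (Q : ℝ) ^ 2 ^ j * S = ((Q ^ 2 ^ j) ^ 2 - 1 : ℝ) - Q * N := by
    have := congrArg Complex.re h3
    rw [Complex.ofReal_re] at this
    rw [this]
    norm_cast
  have h6 : ((Q : ℝ) ^ 2 ^ j) ^ 2 ≤ Q * N + 4 * Q * Q ^ 2 ^ j := by
    exact_mod_cast h1.trans (Nat.add_le_add_right h2 _)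
  have hpos : (0 : ℝ) < (Q : ℝ) ^ 2 ^ j := by
    have : (0 : ℝ) < Q := by exact_mod_cast (by omega : 0 < Q)
    positivity
  have h7 : (Q : ℝ) ^ 2 ^ j * S ≤ Q ^ 2 ^ j * (4 * Q) := by linarith
  exact le_of_mul_le_mul_left h7 hpos

/-- The **Weil bound** for Kloosterman sums over a finite field of odd characteristic. -/
theorem exists_real_kloostermanSum_eq_and_abs_le {k : Type*} [Field k] [Finite k]
    (hk : ringChar k ≠ 2) {ψ : AddChar k ℂ} (hψ : ψ ≠ 1) {γ : k} (hγ : γ ≠ 0) :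
    ∃ x : ℝ, kloostermanSum ψ γ = x ∧ |x| ≤ 2 * √(Nat.card k) := by
  classical
  let _ := Fintype.ofFinite k
  rw [Nat.card_eq_fintype_card]
  set Q := Fintype.card k with hQ
  have hQ1 : 1 < Q := Fintype.one_lt_card
  have hs : 0 < √(Q : ℝ) := Real.sqrt_pos.2 (by exact_mod_cast (by omega : 0 < Q))
  choose x hx using fun c => exists_real_kloostermanSum_eq (AddChar.mulShift ψ c) γ
  set u : k → ℝ := fun c => x c / √Q
  have hu : ∀ c, kloostermanSum (AddChar.mulShift ψ c) γ = ((√Q * u c : ℝ) : ℂ) := fun c => by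
    rw [hx, mul_div_cancel₀ _ hs.ne']
  have h1 := hx 1
  rw [AddChar.mulShift_one] at h1
  refine ⟨x 1, h1, ?_⟩
  by_contra! hlt
  have hu1 : 2 < |u 1| := by
    rw [abs_div, abs_of_pos hs, lt_div_iff₀ hs]; exact hlt
  obtain ⟨δ, hδ, hgrow⟩ := exists_linear_le_chebyshevIterate hu1
  obtain ⟨j₁, hj₁⟩ := exists_nat_gt (6 * Q / δ)
  -- The other terms total at least `-2 * Q`, so the term at `1` is at most `6 * Q`; `j₁` makes it
  -- larger. The second entry makes the extension large enough for the count.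
  set j := max j₁ (2 * Q * (Q + 1)) with hj
  have hjQ : 2 * Q * (Q + 1) < Q ^ 2 ^ j :=
    calc 2 * Q * (Q + 1) ≤ j := le_max_right _ _
      _ < 2 ^ j := Nat.lt_two_pow_self
      _ < Q ^ 2 ^ j := Nat.lt_pow_self hQ1
  have hle := sum_chebyshevIterate_le hk hψ hγ u hu j hjQ
  rw [← hQ, ← Finset.add_sum_erase _ _
    (Finset.mem_erase.2 ⟨one_ne_zero, Finset.mem_univ (1 : k)⟩)] at hle
  have hrest : -(2 * Q : ℝ) ≤
      ∑ c ∈ (Finset.univ.erase (0 : k)).erase 1, chebyshevIterate (u c) (j + 1) := by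
    have hc := Finset.card_nsmul_le_sum ((Finset.univ.erase (0 : k)).erase 1)
      (fun c => chebyshevIterate (u c) (j + 1)) (-2) (fun c _ => chebyshevIterate_succ_ge _ _)
    refine le_trans ?_ hc
    rw [nsmul_eq_mul]
    have : (((Finset.univ.erase (0 : k)).erase 1).card : ℝ) ≤ Q := by
      exact_mod_cast Finset.card_le_univ _
    linarith
  have hg := hgrow j
  have hjj : (j₁ : ℝ) ≤ j := by exact_mod_cast le_max_left _ _
  rw [div_lt_iff₀ hδ] at hj₁
  nlinarith

/-! ### Lower bounds for Kloosterman sums -/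

lemma kloostermanSum_map {k R S : Type*} [Field k] [Finite k] [CommRing R] [CommRing S]
    (f : R →+* S) (ψ : AddChar k R) (α : k) :
    f (kloostermanSum ψ α) = kloostermanSum ((f : R →* S).compAddChar ψ) α := by
  simp [kloostermanSum]

lemma AddChar.exists_compAddChar_eq {A R S : Type*} [AddMonoid A] [CommRing R] [CommRing S]
    {f : R →+* S} (hf : Function.Injective f) (ψ : AddChar A S) (h : ∀ x, ψ x ∈ f.range) :
    ∃ ψ' : AddChar A R, (f : R →* S).compAddChar ψ' = ψ := by
  choose g hg using h
  refine ⟨{ toFun := g, map_zero_eq_one' := hf ?_, map_add_eq_mul' := fun x y => hf ?_ }, ?_⟩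
  · rw [hg, map_one, AddChar.map_zero_eq_one]
  · rw [map_mul, hg, hg, hg, AddChar.map_add_eq_mul]
  · ext x
    exact hg x

lemma AddChar.pow_char_eq_one {k R : Type*} [Field k] [CommRing R] (p : ℕ) [CharP k p]
    (ψ : AddChar k R) (x : k) : ψ x ^ p = 1 := by
  rw [← AddChar.map_nsmul_eq_pow, nsmul_eq_mul, CharP.cast_eq_zero, zero_mul,
    AddChar.map_zero_eq_one]

/-- A Kloosterman sum is congruent to `1` modulo the primes above the characteristic. -/
lemma kloostermanSum_eq_one_of_charP {k R : Type*} [Field k] [Finite k] [CommRing R] [IsDomain R]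
    (p : ℕ) [Fact p.Prime] [CharP k p] [CharP R p] (ψ : AddChar k R) (α : k) :
    kloostermanSum ψ α = 1 := by
  classical
  let _ := Fintype.ofFinite k
  have h1 : ∀ x, ψ x = 1 := fun x => by
    have h := AddChar.pow_char_eq_one p ψ x
    have : (ψ x - 1) ^ p = 0 := by rw [sub_pow_char, h, one_pow, sub_self]
    exact sub_eq_zero.1 (pow_eq_zero_iff (Fact.out : p.Prime).ne_zero |>.1 this)
  have hQ : (Fintype.card k : R) = 0 := by
    obtain ⟨n, -, hn⟩ := FiniteField.card k p
    rw [hn, Nat.cast_pow, CharP.cast_eq_zero, zero_pow n.ne_zero]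
  rw [kloostermanSum_eq]
  simp only [h1]
  rw [Finset.sum_ite, Finset.sum_const_zero, zero_add, Finset.sum_const, nsmul_eq_mul, mul_one,
    Finset.filter_ne', Finset.card_erase_of_mem (Finset.mem_univ _), Finset.card_univ,
    Nat.cast_sub Fintype.card_pos, hQ]
  simp

lemma NumberField.not_isUnit_prime (K : Type*) [Field K] [NumberField K] {p : ℕ}
    (hp : p.Prime) : ¬ IsUnit (p : NumberField.RingOfIntegers K) := by
  intro h
  have h1 := h.map (Algebra.norm ℤ)
  rw [show (p : NumberField.RingOfIntegers K) = algebraMap ℤ _ (p : ℤ) by simp,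
    Algebra.norm_algebraMap, isUnit_pow_iff Module.finrank_pos.ne', Int.isUnit_iff] at h1
  have := hp.one_lt
  omega

open NumberField in
lemma kloostermanSum_ne_zero_and_sq_ne {k K : Type*} [Field k] [Finite k] [Field K] [NumberField K]
    (p : ℕ) [Fact p.Prime] [CharP k p] (ψ : AddChar k (𝓞 K)) (α : k) :
    kloostermanSum ψ α ≠ 0 ∧ 4 * (Nat.card k : 𝓞 K) - kloostermanSum ψ α ^ 2 ≠ 0 := by
  have hp : p.Prime := Fact.out
  obtain ⟨m, hm, hle⟩ := Ideal.exists_le_maximal (Ideal.span {(p : 𝓞 K)})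
    (fun h => NumberField.not_isUnit_prime K hp (Ideal.span_singleton_eq_top.1 h))
  let π := Ideal.Quotient.mk m
  have hp0 : (p : 𝓞 K ⧸ m) = 0 := by
    rw [← map_natCast π]
    exact Ideal.Quotient.eq_zero_iff_mem.2 (hle (Ideal.mem_span_singleton_self _))
  have : CharP (𝓞 K ⧸ m) p := (CharP.charP_iff_prime_eq_zero hp).2 hp0
  have h1 : π (kloostermanSum ψ α) = 1 := by
    rw [kloostermanSum_map]; exact kloostermanSum_eq_one_of_charP p _ α
  have hQ : (Nat.card k : 𝓞 K ⧸ m) = 0 := by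
    let _ := Fintype.ofFinite k
    obtain ⟨n, -, hn⟩ := FiniteField.card k p
    rw [Nat.card_eq_fintype_card, hn, Nat.cast_pow, CharP.cast_eq_zero, zero_pow n.ne_zero]
  constructor
  · intro h
    rw [h, map_zero] at h1
    exact zero_ne_one h1
  · intro h
    have h2 := congrArg π h
    rw [map_sub, map_mul, map_pow, h1, map_natCast, hQ, map_zero] at h2
    simp at h2

open NumberField in
/-- Liouville's inequality: an algebraic integer whose conjugates are bounded is not small. -/
lemma one_le_norm_mul_pow {K : Type*} [Field K] [NumberField K] {x : 𝓞 K} (hx : x ≠ 0) {M : ℝ}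
    (hM : ∀ φ : K →+* ℂ, ‖φ x‖ ≤ M) (φ : K →+* ℂ) :
    1 ≤ ‖φ x‖ * M ^ (Module.finrank ℚ K - 1) := by
  classical
  have h1 := Algebra.norm_eq_prod_embeddings ℚ ℂ (x : K)
  rw [← Algebra.coe_norm_int] at h1
  have h2 : ∏ σ : K →ₐ[ℚ] ℂ, ‖σ x‖ = ‖((Algebra.norm ℤ x : ℤ) : ℂ)‖ := by
    rw [← norm_prod, ← h1]
    simp
  have h3 : (1 : ℝ) ≤ ‖((Algebra.norm ℤ x : ℤ) : ℂ)‖ := by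
    rw [Complex.norm_intCast]
    exact_mod_cast Int.one_le_abs (Algebra.norm_ne_zero_iff.2 hx)
  rw [← h2, ← Finset.mul_prod_erase _ _ (Finset.mem_univ (RingHom.equivRatAlgHom K ℂ φ))] at h3
  refine h3.trans (mul_le_mul_of_nonneg_left ?_ (norm_nonneg _))
  have h4 : ∏ σ ∈ Finset.univ.erase (RingHom.equivRatAlgHom K ℂ φ), ‖σ (x : K)‖ ≤
      ∏ _σ ∈ Finset.univ.erase (RingHom.equivRatAlgHom K ℂ φ), M :=
    Finset.prod_le_prod (fun _ _ => norm_nonneg _) (fun σ _ => hM (σ : K →+* ℂ))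
  refine h4.trans_eq ?_
  rw [Finset.prod_const, Finset.card_erase_of_mem (Finset.mem_univ _), Finset.card_univ,
    AlgHom.card]

open NumberField in
theorem exists_real_kloostermanSum_bounds {k : Type*} [Field k] [Finite k] (p : ℕ) [Fact p.Prime]
    [CharP k p] (hp : p ≠ 2) {ψ : AddChar k ℂ} (hψ : ψ ≠ 1) {γ : k} (hγ : γ ≠ 0) :
    ∃ x : ℝ, kloostermanSum ψ γ = x ∧ |x| ≤ 2 * √(Nat.card k) ∧
      1 ≤ |x| * (4 * Nat.card k) ^ (p - 2) ∧
      1 ≤ (4 * Nat.card k - x ^ 2) * (4 * Nat.card k) ^ (p - 2) := by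
  classical
  have hk : ringChar k ≠ 2 := by rwa [ringChar.eq k p]
  have : NeZero p := ⟨(Fact.out : p.Prime).ne_zero⟩
  let K := CyclotomicField p ℚ
  have : IsCyclotomicExtension {p} ℚ K := CyclotomicField.isCyclotomicExtension p ℚ
  have : NumberField K := IsCyclotomicExtension.numberField {p} ℚ K
  have hfin : Module.finrank ℚ K - 1 = p - 2 := by
    rw [IsCyclotomicExtension.Rat.finrank (K := K) p, Nat.totient_prime Fact.out]
    omega
  obtain ⟨φ₀⟩ : Nonempty (K →+* ℂ) := inferInstance
  have hζ := IsCyclotomicExtension.zeta_spec p ℚ K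
  -- The values of `ψ` are `p`-th roots of unity, so `ψ` descends to the cyclotomic field and then
  -- to its integers.
  obtain ⟨ψK, hψK⟩ := AddChar.exists_compAddChar_eq φ₀.injective ψ (fun x => by
    obtain ⟨i, -, hi⟩ := (hζ.map_of_injective φ₀.injective).eq_pow_of_pow_eq_one
      (AddChar.pow_char_eq_one p ψ x)
    exact ⟨IsCyclotomicExtension.zeta p ℚ K ^ i, by rw [map_pow, hi]⟩)
  obtain ⟨ψO, hψO⟩ := AddChar.exists_compAddChar_eq
    (f := algebraMap (𝓞 K) K) RingOfIntegers.coe_injective ψK (fun x => by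
      have : IsIntegral ℤ (ψK x) := by
        refine IsIntegral.of_pow (n := p) (Fact.out : p.Prime).pos ?_
        rw [AddChar.pow_char_eq_one p ψK x]
        exact isIntegral_one
      exact ⟨⟨ψK x, this⟩, rfl⟩)
  set κ := kloostermanSum ψO γ with hκ
  have hκφ : ∀ φ : K →+* ℂ, φ (κ : K) = kloostermanSum ((φ : K →* ℂ).compAddChar ψK) γ := by
    intro φ
    rw [hκ, ← hψO, ← kloostermanSum_map φ]
    congr 1
    exact kloostermanSum_map (algebraMap (𝓞 K) K) ψO γ
  have hreal : ∀ φ : K →+* ℂ, ∃ x : ℝ, φ (κ : K) = x ∧ |x| ≤ 2 * √(Nat.card k) := by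
    intro φ
    rw [hκφ]
    refine exists_real_kloostermanSum_eq_and_abs_le hk (fun h => hψ ?_) hγ
    rw [← hψK]
    ext x
    have hx := DFunLike.congr_fun h x
    have : ψK x = 1 := φ.injective (by rw [map_one]; exact hx)
    simp [this]
  have hQ1 : (1 : ℝ) ≤ Nat.card k := by exact_mod_cast Nat.card_pos
  have hsq : √(Nat.card k : ℝ) ^ 2 = Nat.card k := Real.sq_sqrt (by linarith)
  have hs1 : 1 ≤ √(Nat.card k : ℝ) := by rw [Real.one_le_sqrt]; exact hQ1
  have hb : ∀ x : ℝ, |x| ≤ 2 * √(Nat.card k) → |x| ≤ 4 * Nat.card k ∧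
      0 ≤ 4 * Nat.card k - x ^ 2 ∧ 4 * Nat.card k - x ^ 2 ≤ 4 * (Nat.card k : ℝ) := by
    intro x hx
    refine ⟨by nlinarith, ?_, by nlinarith [sq_nonneg x]⟩
    rw [← sq_abs]
    nlinarith [abs_nonneg x]
  obtain ⟨hne1, hne2⟩ := kloostermanSum_ne_zero_and_sq_ne p ψO γ
  have h4 : ∀ (φ : K →+* ℂ) (x : ℝ), φ (κ : K) = x →
      φ ((4 * (Nat.card k : 𝓞 K) - κ ^ 2 : 𝓞 K) : K) = ((4 * Nat.card k - x ^ 2 : ℝ) : ℂ) := by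
    intro φ x hx
    have e : ((4 * (Nat.card k : 𝓞 K) - κ ^ 2 : 𝓞 K) : K) = 4 * (Nat.card k : K) - (κ : K) ^ 2 := by
      change algebraMap (𝓞 K) K _ = _
      rw [map_sub, map_mul, map_pow, map_ofNat, map_natCast]
    rw [e, map_sub, map_mul, map_pow, map_ofNat, map_natCast, hx]
    push_cast
    rfl
  obtain ⟨x, hx, hxb⟩ := hreal φ₀
  refine ⟨x, ?_, hxb, ?_, ?_⟩
  · rw [← hx, hκφ, hψK]
  · have := one_le_norm_mul_pow hne1 (M := 4 * Nat.card k) (fun φ => by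
      obtain ⟨y, hy, hyb⟩ := hreal φ
      rw [← hκ, hy, Complex.norm_real]
      exact (hb y hyb).1) φ₀
    rwa [← hκ, hx, Complex.norm_real, hfin] at this
  · have := one_le_norm_mul_pow hne2 (M := 4 * Nat.card k) (fun φ => by
      obtain ⟨y, hy, hyb⟩ := hreal φ
      rw [← hκ, h4 φ y hy, Complex.norm_real, Real.norm_of_nonneg (hb y hyb).2.1]
      exact (hb y hyb).2.2) φ₀
    rwa [← hκ, h4 φ₀ x hx, Complex.norm_real, hfin, Real.norm_of_nonneg (hb x hxb).2.1] at this

/-! ### Kloosterman angles -/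

/-- Apply `sin t ≤ t` to `θ`, `π - θ` and `|π / 2 - θ|`. -/
lemma mem_Icc_union_Icc_of_le_sin_of_le_abs_cos {ε θ : ℝ} (h0 : 0 ≤ θ) (hπ : θ ≤ Real.pi)
    (hsin : ε ≤ Real.sin θ) (hcos : ε ≤ |Real.cos θ|) :
    θ ∈ Set.Icc ε (Real.pi / 2 - ε) ∪ Set.Icc (Real.pi / 2 + ε) (Real.pi - ε) := by
  have h1 : ε ≤ θ := hsin.trans (Real.sin_le h0)
  have h2 : ε ≤ Real.pi - θ := by
    have := Real.sin_le (sub_nonneg.2 hπ)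
    rw [Real.sin_pi_sub] at this
    exact hsin.trans this
  rcases le_total θ (Real.pi / 2) with h | h
  · left
    have hc : 0 ≤ Real.cos θ := Real.cos_nonneg_of_mem_Icc ⟨by linarith, h⟩
    rw [abs_of_nonneg hc] at hcos
    have := Real.sin_le (sub_nonneg.2 h)
    rw [Real.sin_pi_div_two_sub] at this
    exact ⟨h1, by linarith⟩
  · right
    have hc : Real.cos θ ≤ 0 := Real.cos_nonpos_of_pi_div_two_le_of_le h (by linarith)
    rw [abs_of_nonpos hc] at hcos
    have := Real.sin_le (sub_nonneg.2 h)
    rw [Real.sin_sub_pi_div_two] at this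
    exact ⟨by linarith, by linarith⟩

lemma le_sin_arccos_and_le_abs {Q x : ℝ} {n : ℕ} (hQ : 1 ≤ Q)
    (h1 : 1 ≤ |x| * (4 * Q) ^ n) (h2 : 1 ≤ (4 * Q - x ^ 2) * (4 * Q) ^ n) :
    ((4 * Q) ^ (n + 1))⁻¹ ≤ Real.sin (Real.arccos (x / (2 * √Q))) ∧
      ((4 * Q) ^ (n + 1))⁻¹ ≤ |x / (2 * √Q)| := by
  have hsq : √Q ^ 2 = Q := Real.sq_sqrt (by linarith)
  have hs1 : 1 ≤ √Q := by rw [Real.one_le_sqrt]; exact hQ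
  have hpos : 0 < (4 * Q) ^ n := by positivity
  constructor
  · rw [Real.sin_arccos]
    have e : 1 - (x / (2 * √Q)) ^ 2 = (4 * Q - x ^ 2) / (4 * Q) := by
      rw [div_pow, mul_pow, hsq]; field_simp; ring
    have hle : ((4 * Q) ^ (n + 1))⁻¹ ≤ 1 - (x / (2 * √Q)) ^ 2 := by
      rw [e, inv_le_iff_one_le_mul₀ (by positivity), pow_succ (4 * Q), div_mul_eq_mul_div,
        ← mul_assoc, mul_div_cancel_right₀ _ (by positivity)]
      exact h2
    have h0 : 0 ≤ 1 - (x / (2 * √Q)) ^ 2 := le_trans (by positivity) hle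
    -- A number in `[0, 1]` is at most its square root, so the bound on `sin ^ 2` passes to `sin`.
    refine hle.trans (Real.le_sqrt_of_sq_le ?_)
    nlinarith [sq_nonneg (x / (2 * √Q))]
  · rw [abs_div, abs_of_pos (by positivity : 0 < 2 * √Q), inv_le_iff_one_le_mul₀ (by positivity),
      div_mul_eq_mul_div, le_div_iff₀ (by positivity), one_mul, pow_succ]
    calc 2 * √Q ≤ 1 * (4 * Q) := by nlinarith
      _ ≤ (|x| * (4 * Q) ^ n) * (4 * Q) := by gcongr
      _ = _ := by ring

lemma rpow_neg_le_inv_pow {N Q : ℝ} {p : ℕ} (hp : 2 ≤ p) (hN : 2 ≤ N) (hQ : 0 < Q) (hQN : Q ≤ N) :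
    N ^ (-(6 * (p : ℝ) - 4)) ≤ ((4 * Q) ^ (p - 2 + 1))⁻¹ := by
  rw [Real.rpow_neg (by linarith)]
  refine inv_anti₀ (by positivity) ?_
  -- `4 ≤ N ^ 2` absorbs the constant, and `3 * (p - 1) ≤ 6 * p - 4` leaves room to spare.
  calc (4 * Q) ^ (p - 2 + 1) ≤ (N ^ 3) ^ (p - 2 + 1) := by
        gcongr
        have h4 : 4 ≤ N ^ 2 := by nlinarith
        nlinarith
    _ = N ^ ((3 * (p - 2 + 1) : ℕ) : ℝ) := by rw [← pow_mul, Real.rpow_natCast]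
    _ ≤ N ^ (6 * (p : ℝ) - 4) := by
        refine Real.rpow_le_rpow_of_exponent_le (by linarith) ?_
        obtain ⟨m, rfl⟩ := Nat.exists_eq_add_of_le hp
        rw [show 2 + m - 2 + 1 = m + 1 by omega]
        push_cast
        have : (0 : ℝ) ≤ m := Nat.cast_nonneg m
        linarith

/-! ### Angles at the places of the rational function field -/

section Places

variable {F : Type*} [Field F]

lemma placeRep_ne_zero {v : HeightOneSpectrum F[X]} (hv : v.asIdeal ≠ Ideal.span {X}) :
    placeRep v ≠ 0 := by
  intro h
  have hX : X ∈ v.asIdeal := Ideal.Quotient.eq_zero_iff_mem.1 h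
  have hmax : (Ideal.span {(X : F[X])}).IsMaximal :=
    PrincipalIdealRing.isMaximal_of_irreducible irreducible_X
  exact hv (hmax.eq_of_le v.isPrime.ne_top
    ((Ideal.span_singleton_le_iff_mem _).2 hX)).symm

variable [Finite F]

lemma placeChar_ne_one {R : Type*} [CommRing R] {ψ : AddChar F R} (hψ : ψ ≠ 1)
    {v : HeightOneSpectrum F[X]} {β : ResField v} (hβ : β ≠ 0) : placeChar ψ v β ≠ 1 := by
  refine AddChar.compAddMonoidHom_ne_one hψ ?_
  refine (Algebra.trace_surjective F (ResField v)).comp fun y => ⟨β⁻¹ * y, ?_⟩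
  exact mul_inv_cancel_left₀ hβ y

lemma natCard_resField (v : HeightOneSpectrum F[X]) :
    Nat.card (ResField v) = Nat.card F ^ placeDeg v :=
  Module.natCard_eq_pow_finrank

theorem kloostermanAngle_bounds (p : ℕ) [Fact p.Prime] [CharP F p] (hp : p ≠ 2)
    {ψ : AddChar F (AlgebraicClosure ℚ)} (hψ : ψ ≠ 1) (ι : AlgebraicClosure ℚ →+* ℂ) (γ : Fˣ)
    {v : HeightOneSpectrum F[X]} (hv : v.asIdeal ≠ Ideal.span {X}) :
    ι (placeKloosterman ψ γ v) =
        ((2 * (Nat.card F : ℝ) ^ ((placeDeg v : ℝ) / 2) *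
          Real.cos (kloostermanAngle ψ ι γ v) : ℝ) : ℂ) ∧
      ((4 * (Nat.card F : ℝ) ^ placeDeg v) ^ (p - 2 + 1))⁻¹ ≤
        Real.sin (kloostermanAngle ψ ι γ v) ∧
      ((4 * (Nat.card F : ℝ) ^ placeDeg v) ^ (p - 2 + 1))⁻¹ ≤
        |Real.cos (kloostermanAngle ψ ι γ v)| := by
  have : CharP (ResField v) p :=
    charP_of_injective_algebraMap (algebraMap F (ResField v)).injective p
  have hne : (ι : AlgebraicClosure ℚ →* ℂ).compAddChar (placeChar ψ v (placeRep v)) ≠ 1 := by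
    obtain ⟨y, hy⟩ := AddChar.ne_one_iff.1 (placeChar_ne_one hψ (placeRep_ne_zero hv))
    exact AddChar.ne_one_iff.2 ⟨y, fun h => hy (ι.injective (by rw [map_one]; exact h))⟩
  obtain ⟨x, hx, hxb, h1, h2⟩ := exists_real_kloostermanSum_bounds p hp hne
    (γ := algebraMap F (ResField v) γ) (by simp)
  rw [← kloostermanSum_map] at hx
  change ι (placeKloosterman ψ γ v) = x at hx
  have hQ : (Nat.card (ResField v) : ℝ) = (Nat.card F : ℝ) ^ placeDeg v := by
    rw [natCard_resField]; push_cast; rfl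
  rw [hQ] at hxb h1 h2
  set Q := (Nat.card F : ℝ) ^ placeDeg v with hQdef
  have hQ1 : 1 ≤ Q := one_le_pow₀ (by exact_mod_cast Nat.card_pos)
  have hs : (Nat.card F : ℝ) ^ ((placeDeg v : ℝ) / 2) = √Q := by
    rw [Real.sqrt_eq_rpow, hQdef, ← Real.rpow_natCast, ← Real.rpow_mul (Nat.cast_nonneg _)]
    congr 1
    ring
  have hpos : 0 < 2 * √Q := by positivity
  have habs : |x / (2 * √Q)| ≤ 1 := by
    rw [abs_div, abs_of_pos hpos, div_le_one hpos]; exact hxb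
  have hangle : kloostermanAngle ψ ι γ v = Real.arccos (x / (2 * √Q)) := by
    rw [kloostermanAngle, hx, hs, Complex.ofReal_re]
  have hcos : Real.cos (kloostermanAngle ψ ι γ v) = x / (2 * √Q) := by
    rw [hangle, Real.cos_arccos (abs_le.1 habs).1 (abs_le.1 habs).2]
  obtain ⟨h3, h4⟩ := le_sin_arccos_and_le_abs hQ1 h1 h2
  refine ⟨?_, hangle ▸ h3, hcos ▸ h4⟩
  rw [hx, hs, hcos, mul_div_cancel₀ _ hpos.ne']

lemma support_kloostermanAngleMeasure_subset (ψ : AddChar F (AlgebraicClosure ℚ))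
    (ι : AlgebraicClosure ℚ →+* ℂ) (γ : Fˣ) (a : ℕ) {s : Set ℝ} (hs : IsClosed s)
    (h : kloostermanAngle ψ ι γ '' placesDvd F a ⊆ s) :
    (kloostermanAngleMeasure ψ ι γ a).support ⊆ s := by
  refine Measure.support_subset_of_isClosed hs ?_
  rw [mem_ae_iff, kloostermanAngleMeasure, Measure.smul_apply,
    Measure.sum_apply _ hs.isOpen_compl.measurableSet]
  have : ∀ v : placesDvd F a, Measure.dirac (kloostermanAngle ψ ι γ v) sᶜ = 0 := fun v => by
    rw [Measure.dirac_apply' _ hs.isOpen_compl.measurableSet]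
    simp [h ⟨v, v.2, rfl⟩]
  simp [this]

end Places
end

theorem mainTheorem7 (p : ℕ) [Fact p.Prime] (hp : Odd p) :
    ∃ σ : ℝ, σ = 6 * (p : ℝ) - 4 ∧ 0 < σ ∧
      ∀ (F : Type*) [Field F] [Finite F] [CharP F p]
        (ψ : AddChar F (AlgebraicClosure ℚ)) (_ : ψ ≠ 1)
        (ι : AlgebraicClosure ℚ →+* ℂ) (γ : Fˣ) (a : ℕ) (_ : 1 ≤ a) (ε : ℝ)
        (_ : ε = ((Nat.card F : ℝ) ^ a) ^ (-σ)),
        -- the angles are well defined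
        (∀ v ∈ placesDvd F a,
          ι (placeKloosterman ψ γ v) =
            ((2 * (Nat.card F : ℝ) ^ ((placeDeg v : ℝ) / 2) *
              Real.cos (kloostermanAngle ψ ι γ v) : ℝ) : ℂ)) ∧
        kloostermanAngle ψ ι γ '' placesDvd F a ⊆
          Set.Icc ε (Real.pi / 2 - ε) ∪ Set.Icc (Real.pi / 2 + ε) (Real.pi - ε) ∧
        (kloostermanAngleMeasure ψ ι γ a).support ⊆
          Set.Icc ε (Real.pi / 2 - ε) ∪ Set.Icc (Real.pi / 2 + ε) (Real.pi - ε) := by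
  have hp2 : 2 ≤ p := (Fact.out : p.Prime).two_le
  have hpne : p ≠ 2 := by rintro rfl; exact absurd hp (by decide)
  refine ⟨6 * (p : ℝ) - 4, rfl, ?_, ?_⟩
  · have : (2 : ℝ) ≤ p := by exact_mod_cast hp2
    linarith
  intro F _ _ _ ψ hψ ι γ a ha ε hε
  have himage : kloostermanAngle ψ ι γ '' placesDvd F a ⊆
      Set.Icc ε (Real.pi / 2 - ε) ∪ Set.Icc (Real.pi / 2 + ε) (Real.pi - ε) := by
    rintro _ ⟨v, ⟨hv, hdvd⟩, rfl⟩
    obtain ⟨-, h1, h2⟩ := kloostermanAngle_bounds p hpne hψ ι γ hv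
    have hq : (2 : ℝ) ≤ Nat.card F := by exact_mod_cast Finite.one_lt_card
    have hle : ε ≤ ((4 * (Nat.card F : ℝ) ^ placeDeg v) ^ (p - 2 + 1))⁻¹ := by
      rw [hε]
      refine rpow_neg_le_inv_pow hp2 ?_ (by positivity) ?_
      · exact hq.trans (le_self_pow₀ (by linarith) (by omega))
      · exact pow_le_pow_right₀ (by linarith) (Nat.le_of_dvd (by omega) hdvd)
    exact mem_Icc_union_Icc_of_le_sin_of_le_abs_cos (Real.arccos_nonneg _) (Real.arccos_le_pi _)
      (hle.trans h1) (hle.trans h2)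
  exact ⟨fun v hv => (kloostermanAngle_bounds p hpne hψ ι γ hv.1).1, himage,
    support_kloostermanAngleMeasure_subset ψ ι γ a (isClosed_Icc.union isClosed_Icc) himage⟩
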